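/- All graphs are finite, simple and undirected. For a graph $G$, let $\alpha(G)$ be its independence number, and let $\rho(G)$ be its packing number, that is, the maximum cardinality of a set of vertices of $G$ whose pairwise distances are all at least $3$. For a connected graph $G$, an independent broadcast on $G$ is a function $f:V(G)\to\{0,1,2,\ldots\}$ such that $f(x)$ is at most the eccentricity of $x$ in $G$ for every vertex $x$, and ${\rm dist}_G(x,y)>\max\{f(x),f(y)\}$ for every two distinct vertices $x,y$ with $f(x),f(y)>0$; the broadcast independence number $\alpha_b(G)$ is the maximum of $\sum_{x\in V(G)}f(x)$ over all independent broadcasts $f$ on $G$. Theorem. For every positive integer $k$, there is a connected graph $G$ of girth at least $k$ and minimum degree at least $k$ such that $$\alpha_b(G)\geq 2\left(1-\frac1k\right)\alpha(G)\qquad\mbox{and}\qquad \rho(G)\geq\left(1-\frac1k\right)\alpha(G).$$ -/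

import Mathlib

namespace SimpleGraph

variable {V : Type*}

/-- An independent broadcast on a (connected) graph `G`: a function `f : V → ℕ` such that `f x` is
at most the eccentricity of `x`, and any two distinct vertices at which `f` is positive have
distance larger than both values of `f`. -/
def IsIndependentBroadcast (G : SimpleGraph V) (f : V → ℕ) : Prop :=
  (∀ x, (f x : ℕ∞) ≤ G.eccent x) ∧
    ∀ x y, x ≠ y → 0 < f x → 0 < f y → ((max (f x) (f y) : ℕ) : ℕ∞) < G.edist x y

/-- The broadcast independence number: the maximum weight `∑ x, f x` of an independent broadcast
on `G`. The maximum exists for every finite connected graph, see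
`isGreatest_broadcastIndepNum`. -/
noncomputable def broadcastIndepNum [Fintype V] (G : SimpleGraph V) : ℕ :=
  sSup {w | ∃ f : V → ℕ, G.IsIndependentBroadcast f ∧ ∑ x, f x = w}

/-- A packing: a set of vertices with pairwise distances at least `3`. -/
def IsPacking (G : SimpleGraph V) (P : Finset V) : Prop :=
  ∀ x ∈ P, ∀ y ∈ P, x ≠ y → 3 ≤ G.edist x y

/-- The packing number: the maximum cardinality of a packing in a finite graph. -/
noncomputable def packingNum (G : SimpleGraph V) : ℕ :=
  sSup {n | ∃ P : Finset V, G.IsPacking P ∧ P.card = n}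

theorem isGreatest_broadcastIndepNum [Fintype V] {G : SimpleGraph V} (hG : G.Connected) :
    IsGreatest {w | ∃ f : V → ℕ, G.IsIndependentBroadcast f ∧ ∑ x, f x = w}
      G.broadcastIndepNum := by
  have hne : {w | ∃ f : V → ℕ, G.IsIndependentBroadcast f ∧ ∑ x, f x = w}.Nonempty :=
    ⟨_, fun _ => 0, ⟨by simp, by simp⟩, rfl⟩
  have hbdd : BddAbove {w | ∃ f : V → ℕ, G.IsIndependentBroadcast f ∧ ∑ x, f x = w} := by
    refine ⟨∑ x, (G.eccent x).toNat, ?_⟩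
    rintro _ ⟨f, hf, rfl⟩
    refine Finset.sum_le_sum fun x _ => ?_
    obtain ⟨v, hv⟩ := G.exists_edist_eq_eccent_of_finite x
    have htop : G.eccent x ≠ ⊤ := hv ▸ edist_ne_top_iff_reachable.mpr (hG.preconnected x v)
    simpa using ENat.toNat_le_toNat (hf.1 x) htop
  exact ⟨Nat.sSup_mem hne hbdd, fun _ h => le_csSup hbdd h⟩

theorem isGreatest_packingNum [Fintype V] (G : SimpleGraph V) :
    IsGreatest {n | ∃ P : Finset V, G.IsPacking P ∧ P.card = n} G.packingNum := by
  have hne : {n | ∃ P : Finset V, G.IsPacking P ∧ P.card = n}.Nonempty :=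
    ⟨_, ∅, by simp [IsPacking], rfl⟩
  have hbdd : BddAbove {n | ∃ P : Finset V, G.IsPacking P ∧ P.card = n} := by
    refine ⟨Fintype.card V, ?_⟩
    rintro _ ⟨P, -, rfl⟩
    exact P.card_le_univ
  exact ⟨Nat.sSup_mem hne hbdd, fun _ h => le_csSup hbdd h⟩

end SimpleGraph

/-!
Suppose a graph of girth and minimum degree at least `k` has a packing `P` such that every
independent set avoiding `P` has at most `s ≤ |P| / k` elements. Then its independence number is at
most `|P| + s ≤ (1 + 1 / k) |P|`, so `ρ ≥ |P| ≥ (1 - 1 / k) α`. Giving the value `2` to each vertex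
of a packing yields an independent broadcast, whence `α_b ≥ 2 ρ`.

Such a graph is found greedily, without probability. Start with a disjoint union of stars with `k`
leaves each; the centres form `P`, and edges are added between leaves only, which keeps `P` a
packing. An edge `uv` may be added if `u` and `v` have degree less than `D` and distance at least
`k`, so that the girth stays at least `k` (`le_egirth_sup_edge`). Balls of radius `k` have bounded
size, and few vertices have degree `D`, so every large set of leaves contains a positive proportion
of all pairs of leaves as admissible pairs (`le_card_joinable`). By averaging, some admissible
pair destroys a positive proportion `1 / L` of the independent sets of the critical size
(`exists_joinable_mem_indepSubsets`). Initially there are at most `2 ^ n` of these, where `n` is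
the number of leaves, so none is left after `L * n` steps.

The leaves may still have small degree. Repeatedly deleting a leaf with fewer than `k` remaining
leaf neighbors, together with these neighbors, produces an independent set, so few leaves get
deleted (`exists_subset_card_le_forall_le_card_adj`); the centres that lose a leaf are few as well,
and are dropped. Finally, joining different components by edges outside `P` preserves both the
girth and the packing (`exists_connected_extension`).
-/

namespace SimpleGraph

variable {V : Type*}

/-! ### Girth and degree when an edge is added -/

/-- A cycle through the edge `uv` contains a walk from `u` to `v` that avoids this edge and is
shorter by one. -/
theorem exists_walk_of_mem_edges_isCycle {G : SimpleGraph V} {a u v : V} {c : G.Walk a a}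
    (hc : c.IsCycle) (h : s(u, v) ∈ c.edges) :
    ∃ p : G.Walk u v, s(u, v) ∉ p.edges ∧ p.length + 1 = c.length := by
  classical
  have key : ∀ c' : G.Walk u u, c'.IsCycle → c'.snd = v →
      ∃ p : G.Walk u v, s(u, v) ∉ p.edges ∧ p.length + 1 = c'.length := by
    intro c' hc' hv
    cases c' with
    | nil => exact absurd hc' Walk.not_isCycle_nil
    | cons h' p =>
      simp only [Walk.snd_cons] at hv
      subst hv
      rw [Walk.cons_isCycle_iff] at hc'
      exact ⟨p.reverse, by simpa using hc'.2, by simp⟩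
  have hu := c.fst_mem_support_of_mem_edges h
  have hc' := hc.rotate hu
  have hl : (c.rotate u hu).length = c.length := by simp
  have h' : s(u, v) ∈ (c.rotate u hu).edges := (c.rotate_edges u hu).perm.mem_iff.mpr h
  rw [← hl]
  generalize c.rotate u hu = c' at hc' h'
  by_cases hv : c'.snd = v
  · exact key c' hc' hv
  · obtain ⟨p, hp⟩ := key c'.reverse hc'.reverse (by
      cases c' with
      | nil => exact absurd hc' Walk.not_isCycle_nil
      | cons h₁ p =>
        rw [Walk.cons_isCycle_iff] at hc'
        simp only [Walk.snd_cons] at hv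
        have : s(u, v) ∈ p.edges := by
          rw [Walk.edges_cons, List.mem_cons] at h'
          rcases h' with h' | h'
          · grind
          · exact h'
        have h2 := hc'.1.eq_penultimate_of_mem_edges (w := v) this
        rw [Walk.snd_reverse, Walk.penultimate_cons_of_not_nil, h2]
        intro hn
        exact h₁.ne hn.eq.symm)
    exact ⟨p, by simpa using hp⟩

/-- Joining two vertices at distance at least `k - 1` creates no cycle shorter than `k`. -/
theorem le_egirth_sup_edge {G : SimpleGraph V} {k : ℕ} {u v : V} (hG : k ≤ G.egirth)
    (huv : ∀ p : G.Walk u v, k ≤ p.length + 1) : k ≤ (G ⊔ edge u v).egirth := by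
  rw [le_egirth]
  intro a c hc
  have transfer : ∀ {x y : V} (p : (G ⊔ edge u v).Walk x y), s(u, v) ∉ p.edges →
      ∀ e ∈ p.edges, e ∈ G.edgeSet := by
    intro x y p hp e he
    have := p.edges_subset_edgeSet he
    rw [edgeSet_sup] at this
    rcases this with h | h
    · exact h
    · rw [edge, edgeSet_fromEdgeSet] at h
      exact absurd (h.1 ▸ he) hp
  by_cases h : s(u, v) ∈ c.edges
  · obtain ⟨p, hp, hl⟩ := exists_walk_of_mem_edges_isCycle hc h
    have := huv (p.transfer G (transfer p hp))
    rw [Walk.length_transfer] at this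
    exact_mod_cast this.trans hl.le
  · simpa using le_egirth.mp hG a _ (hc.transfer (transfer c h))

/-- A graph in which every edge has an end of degree one (a leaf) is acyclic. -/
theorem isAcyclic_of_forall_adj_exists_leaf {G : SimpleGraph V}
    (h : ∀ u v, G.Adj u v → (G.neighborSet u).Subsingleton ∨ (G.neighborSet v).Subsingleton) :
    G.IsAcyclic := by
  classical
  have key : ∀ u (c : G.Walk u u), c.IsCycle → ¬ (G.neighborSet u).Subsingleton := by
    intro u c hc hs
    exact hc.snd_ne_penultimate
      (hs (c.adj_snd hc.not_nil) (c.adj_penultimate hc.not_nil).symm)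
  intro u c hc
  rcases h _ _ (c.adj_snd hc.not_nil) with h | h
  · exact key u c hc h
  · exact key _ _ (hc.rotate (c.getVert_mem_support 1)) h

/-- In a graph of maximum degree at most `D`, at most `(D + 1) ^ r` vertices can be reached
from a vertex by a walk of length less than `r`. -/
theorem card_walk_lt_le [Fintype V] {G : SimpleGraph V} [G.LocallyFinite] {D : ℕ}
    (hD : ∀ v, G.degree v ≤ D) (r : ℕ) (u : V)
    [DecidablePred fun v => ∃ p : G.Walk u v, p.length < r] :
    (Finset.univ.filter fun v => ∃ p : G.Walk u v, p.length < r).card ≤ (D + 1) ^ r := by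
  classical
  induction r generalizing u with
  | zero => simp
  | succ r ih =>
    calc _ ≤ (insert u ((G.neighborFinset u).biUnion fun w =>
            Finset.univ.filter fun v => ∃ p : G.Walk w v, p.length < r)).card := by
          refine Finset.card_le_card fun v hv => ?_
          obtain ⟨p, hp⟩ := (Finset.mem_filter.mp hv).2
          cases p with
          | nil => simp
          | @cons _ w _ h p =>
            simp only [Walk.length_cons, add_lt_add_iff_right] at hp
            refine Finset.mem_insert_of_mem (Finset.mem_biUnion.mpr ⟨w, ?_, ?_⟩)
            · exact (G.mem_neighborFinset _ _).mpr h
            · simpa using ⟨p, hp⟩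
      _ ≤ (G.neighborFinset u).card * (D + 1) ^ r + 1 :=
          (Finset.card_insert_le _ _).trans
            (Nat.add_le_add_right (Finset.card_biUnion_le_card_mul _ _ _ fun w _ => ih w) 1)
      _ ≤ D * (D + 1) ^ r + (D + 1) ^ r := by
          gcongr
          · exact hD u
          · exact Nat.one_le_pow _ _ (by omega)
      _ = (D + 1) ^ (r + 1) := by ring

theorem degree_sup_edge_le [Fintype V] {G : SimpleGraph V} [DecidableRel G.Adj] {D : ℕ} {u v : V}
    [DecidableRel (G ⊔ edge u v).Adj] (hD : ∀ x, G.degree x ≤ D) (hu : G.degree u < D)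
    (hv : G.degree v < D) (x : V) : (G ⊔ edge u v).degree x ≤ D := by
  classical
  have key : ∀ z, (G ⊔ edge u v).neighborFinset x ⊆ insert z (G.neighborFinset x) → G.degree x < D →
      (G ⊔ edge u v).degree x ≤ D := fun z hz hx =>
    (Finset.card_le_card hz).trans ((Finset.card_insert_le _ _).trans hx)
  by_cases hxu : x = u
  · subst hxu
    refine key v (fun y hy => ?_) hu
    simp only [mem_neighborFinset, sup_adj, edge_adj, Finset.mem_insert] at hy ⊢
    grind
  by_cases hxv : x = v
  · subst hxv
    refine key u (fun y hy => ?_) hv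
    simp only [mem_neighborFinset, sup_adj, edge_adj, Finset.mem_insert] at hy ⊢
    grind
  · refine le_trans (Finset.card_le_card fun y hy => ?_) (hD x)
    simp only [mem_neighborFinset, sup_adj, edge_adj] at hy ⊢
    grind

theorem card_edgeFinset_sup_edge_le {G : SimpleGraph V} [Fintype G.edgeSet] {u v : V}
    [Fintype (G ⊔ edge u v).edgeSet] :
    (G ⊔ edge u v).edgeFinset.card ≤ G.edgeFinset.card + 1 := by
  classical
  refine (Finset.card_le_card fun e he => ?_).trans (Finset.card_insert_le s(u, v) _)
  have he := mem_edgeFinset.mp he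
  rw [edgeSet_sup, edge, edgeSet_fromEdgeSet] at he
  simp only [Finset.mem_insert, mem_edgeFinset]
  rcases he with he | he
  · exact Or.inr he
  · exact Or.inl he.1

/-! ### Greedy destruction of independent sets -/

open Classical in
/-- The independent sets of `G` of cardinality `s` that are contained in `N`. -/
noncomputable def indepSubsets (G : SimpleGraph V) (N : Finset V) (s : ℕ) : Finset (Finset V) :=
  (N.powersetCard s).filter fun S => G.IsIndepSet (S : Set V)

open Classical in
theorem mem_indepSubsets {G : SimpleGraph V} {N S : Finset V} {s : ℕ} :
    S ∈ G.indepSubsets N s ↔ S ⊆ N ∧ S.card = s ∧ G.IsIndepSet (S : Set V) := by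
  rw [indepSubsets, Finset.mem_filter, Finset.mem_powersetCard, and_assoc]

/-- The pairs of vertices that may be joined without creating a vertex of degree more than `D` or
a cycle of length at most `k`, because their degrees are less than `D` and every walk between them
has length at least `k`. -/
def IsJoinable [Fintype V] (G : SimpleGraph V) [DecidableRel G.Adj] (D k : ℕ) (u v : V) : Prop :=
  G.degree u < D ∧ G.degree v < D ∧ ∀ p : G.Walk u v, k ≤ p.length

open Classical in
/-- A set that is large compared with the set of saturated vertices and with the size of a ball
contains quadratically many joinable pairs. -/
theorem le_card_joinable [Fintype V] {G : SimpleGraph V} {D k M : ℕ}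
    (hD : ∀ v, G.degree v ≤ D) (hM : (D + 1) ^ k ≤ M)
    (hsat : (Finset.univ.filter fun v => D ≤ G.degree v).card ≤ 2 * M)
    {S : Finset V} (hS : S.card = 4 * M) :
    2 * M * M ≤ ((S ×ˢ S).filter fun q => G.IsJoinable D k q.1 q.2).card := by
  set T := S.filter fun v => G.degree v < D with hT
  have hTcard : 2 * M ≤ T.card := by
    have h1 : T.card + _ = S.card := S.card_filter_add_card_filter_not (fun v => G.degree v < D)
    have h2 : (S.filter fun v => ¬ G.degree v < D).card ≤ 2 * M :=
      (Finset.card_le_card fun v hv => by simp_all).trans hsat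
    omega
  have hfar : ∀ u ∈ T, M ≤ (T.filter fun v => ∀ p : G.Walk u v, k ≤ p.length).card := by
    intro u _
    have h1 := T.card_filter_add_card_filter_not (fun v => ∀ p : G.Walk u v, k ≤ p.length)
    have h2 : (T.filter fun v => ¬ ∀ p : G.Walk u v, k ≤ p.length).card ≤ M := by
      refine (Finset.card_le_card fun v hv => ?_).trans ((card_walk_lt_le hD k u).trans hM)
      simpa using (Finset.mem_filter.mp hv).2
    omega
  calc 2 * M * M ≤ ∑ u ∈ T, (T.filter fun v => ∀ p : G.Walk u v, k ≤ p.length).card :=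
        (Nat.mul_le_mul_right M hTcard).trans (by
          simpa using Finset.card_nsmul_le_sum T _ M hfar)
    _ = (T.sigma fun u => T.filter fun v => ∀ p : G.Walk u v, k ≤ p.length).card :=
        (Finset.card_sigma _ _).symm
    _ ≤ _ := by
        refine Finset.card_le_card_of_injOn (fun q => (q.1, q.2)) ?_ ?_
        · rintro ⟨u, v⟩ h
          simp only [hT, IsJoinable, Finset.coe_sigma, Set.mem_sigma_iff, Finset.mem_coe,
            Finset.mem_filter] at h ⊢
          grind
        · rintro ⟨u, v⟩ _ ⟨u', v'⟩ _ h
          simpa using h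

open Classical in
/-- By averaging, some joinable pair lies in a positive proportion of the independent sets. -/
theorem exists_joinable_mem_indepSubsets [Fintype V] {G : SimpleGraph V} {D k M L : ℕ}
    {N : Finset V} (hM0 : 0 < M)
    (hD : ∀ v, G.degree v ≤ D) (hM : (D + 1) ^ k ≤ M)
    (hsat : (Finset.univ.filter fun v => D ≤ G.degree v).card ≤ 2 * M)
    (hN : N.card * N.card ≤ L * (2 * M * M)) (hne : (G.indepSubsets N (4 * M)).Nonempty) :
    ∃ u ∈ N, ∃ v ∈ N, G.IsJoinable D k u v ∧ (G.indepSubsets N (4 * M)).card ≤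
      ((G.indepSubsets N (4 * M)).filter fun S => u ∈ S ∧ v ∈ S).card * L := by
  set F := G.indepSubsets N (4 * M) with hF
  set Q := (N ×ˢ N).filter fun q => G.IsJoinable D k q.1 q.2 with hQ
  have hmem : ∀ S ∈ F, S ⊆ N ∧ S.card = 4 * M := fun S hS =>
    have h := mem_indepSubsets.mp hS
    ⟨h.1, h.2.1⟩
  have hcount : ∀ S ∈ F, 2 * M * M ≤ (Q.filter fun q => q.1 ∈ S ∧ q.2 ∈ S).card := by
    intro S hS
    refine (le_card_joinable hD hM hsat (hmem S hS).2).trans (Finset.card_le_card fun q hq => ?_)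
    have := (hmem S hS).1
    simp only [hQ, Finset.mem_filter, Finset.mem_product] at hq ⊢
    exact ⟨⟨⟨this hq.1.1, this hq.1.2⟩, hq.2⟩, hq.1⟩
  have hQne : Q.Nonempty := by
    obtain ⟨S, hS⟩ := hne
    have : 0 < (Q.filter fun q => q.1 ∈ S ∧ q.2 ∈ S).card :=
      lt_of_lt_of_le (by positivity) (hcount S hS)
    exact (Finset.card_pos.mp this).mono (Finset.filter_subset _ _)
  have hdouble : ∑ q ∈ Q, (F.filter fun S => q.1 ∈ S ∧ q.2 ∈ S).card =
      ∑ S ∈ F, (Q.filter fun q => q.1 ∈ S ∧ q.2 ∈ S).card :=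
    Finset.sum_card_bipartiteAbove_eq_sum_card_bipartiteBelow
      (fun (q : V × V) (S : Finset V) => q.1 ∈ S ∧ q.2 ∈ S)
  obtain ⟨q, hq, hle⟩ := Finset.exists_le_of_sum_le hQne (f := fun _ => F.card)
    (g := fun q => (F.filter fun S => q.1 ∈ S ∧ q.2 ∈ S).card * L) (by
      rw [← Finset.sum_mul, hdouble, Finset.sum_const, smul_eq_mul]
      calc Q.card * F.card ≤ (L * (2 * M * M)) * F.card := by
            gcongr
            exact (Finset.card_filter_le _ _).trans (by rwa [Finset.card_product])
        _ = (F.card • (2 * M * M)) * L := by rw [smul_eq_mul]; ring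
        _ ≤ _ := by gcongr; exact Finset.card_nsmul_le_sum F _ _ hcount)
  simp only [hQ, Finset.mem_filter, Finset.mem_product] at hq
  exact ⟨q.1, hq.1.1, q.2, hq.1.2, hq.2, hle⟩

open Classical in
/-- Few vertices of a graph with few edges have large degree. -/
theorem card_le_degree_le [Fintype V] {G : SimpleGraph V} {D a : ℕ} (hD0 : 0 < D)
    (h : 2 * G.edgeFinset.card ≤ a * D) :
    (Finset.univ.filter fun v => D ≤ G.degree v).card ≤ a := by
  refine Nat.le_of_mul_le_mul_right (le_trans ?_ h) hD0
  rw [← G.sum_degrees_eq_twice_card_edges]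
  calc _ ≤ ∑ v ∈ Finset.univ.filter fun v => D ≤ G.degree v, G.degree v := by
        simpa using Finset.card_nsmul_le_sum (Finset.univ.filter fun v => D ≤ G.degree v)
          (fun v => G.degree v) D (by simp)
    _ ≤ _ := Finset.sum_le_sum_of_subset (Finset.subset_univ _)

open Classical in
/-- Adding at most `t` edges greedily, the number of independent sets shrinks exponentially
in `t`. -/
theorem exists_greedy_extension [Fintype V] {G₀ : SimpleGraph V} {D k M L m : ℕ} {N : Finset V}
    (hD0 : 0 < D) (hk : 0 < k)
    (hD : ∀ v, G₀.degree v ≤ D) (hM : (D + 1) ^ k ≤ M) (hg : k ≤ G₀.egirth)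
    (hm : 2 * (G₀.edgeFinset.card + m) ≤ 2 * M * D)
    (hN : N.card * N.card ≤ L * (2 * M * M)) (t : ℕ) (ht : t ≤ m) :
    ∃ G : SimpleGraph V, G₀ ≤ G ∧ (∀ u v, G.Adj u v → ¬ G₀.Adj u v → u ∈ N ∧ v ∈ N) ∧
      k ≤ G.egirth ∧ (∀ v, G.degree v ≤ D) ∧ G.edgeFinset.card ≤ G₀.edgeFinset.card + t ∧
      (G.indepSubsets N (4 * M)).card * L ^ t ≤ 2 ^ N.card * (L - 1) ^ t := by
  have hM0 : 0 < M := lt_of_lt_of_le (by positivity) hM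
  induction t with
  | zero =>
    refine ⟨G₀, le_rfl, fun u v h h' => absurd h h', hg, hD, le_rfl, ?_⟩
    rw [pow_zero, pow_zero, mul_one, mul_one, ← Finset.card_powerset]
    exact Finset.card_le_card fun S hS => Finset.mem_powerset.mpr
      (mem_indepSubsets.mp hS).1
  | succ t ih =>
    obtain ⟨G, hle, hnew, hgG, hdeg, hE, hcard⟩ := ih (by omega)
    rcases (G.indepSubsets N (4 * M)).eq_empty_or_nonempty with he | hne
    · exact ⟨G, hle, hnew, hgG, hdeg, by omega, by simp [he]⟩
    obtain ⟨u, hu, v, hv, hj, hF⟩ := exists_joinable_mem_indepSubsets hM0 hdeg hM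
      (card_le_degree_le hD0 (by nlinarith)) hN hne
    have huv : u ≠ v := by
      rintro rfl
      have := hj.2.2 Walk.nil
      simp only [Walk.length_nil] at this
      omega
    refine ⟨G ⊔ edge u v, hle.trans le_sup_left, ?_, ?_, ?_, ?_, ?_⟩
    · intro x y h h'
      rw [sup_adj, edge_adj] at h
      rcases h with h | h
      · exact hnew x y h h'
      · grind
    · exact le_egirth_sup_edge hgG fun p => (hj.2.2 p).trans (Nat.le_succ _)
    · exact fun x => by convert degree_sup_edge_le hdeg hj.1 hj.2.1 x
    · refine le_trans (le_of_eq ?_)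
        ((card_edgeFinset_sup_edge_le (u := u) (v := v)).trans (Nat.add_le_add_right hE 1))
      congr!
    · have hsub : (G ⊔ edge u v).indepSubsets N (4 * M) ⊆
          (G.indepSubsets N (4 * M)).filter fun S => ¬ (u ∈ S ∧ v ∈ S) := by
        intro S hS
        obtain ⟨h0, h1, h2⟩ := mem_indepSubsets.mp hS
        refine Finset.mem_filter.mpr ⟨mem_indepSubsets.mpr ⟨h0, h1, ?_⟩, ?_⟩
        · exact fun x hx y hy hxy h => h2 hx hy hxy (Or.inl h)
        · rintro ⟨hx, hy⟩
          exact h2 hx hy huv (Or.inr (by simp [edge_adj, huv]))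
      have hsplit := (G.indepSubsets N (4 * M)).card_filter_add_card_filter_not
        (fun S => u ∈ S ∧ v ∈ S)
      have hc := Finset.card_le_card hsub
      generalize ((G ⊔ edge u v).indepSubsets N (4 * M)).card = x at hc ⊢
      generalize ((G.indepSubsets N (4 * M)).filter fun S => ¬ (u ∈ S ∧ v ∈ S)).card = y at *
      generalize ((G.indepSubsets N (4 * M)).filter fun S => u ∈ S ∧ v ∈ S).card = z at *
      generalize (G.indepSubsets N (4 * M)).card = w at *
      have hxw : x * L ≤ w * (L - 1) := by
        cases L with
        | zero => simp
        | succ L =>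
          simp only [Nat.add_sub_cancel]
          nlinarith
      calc x * L ^ (t + 1) = (x * L) * L ^ t := by ring
        _ ≤ (w * (L - 1)) * L ^ t := by gcongr
        _ = (w * L ^ t) * (L - 1) := by ring
        _ ≤ (2 ^ N.card * (L - 1) ^ t) * (L - 1) := by gcongr
        _ = _ := by ring

theorem pow_succ_add_mul_pow_le (b n : ℕ) : b ^ (n + 1) + (n + 1) * b ^ n ≤ (b + 1) ^ (n + 1) := by
  induction n with
  | zero => simp
  | succ n ih =>
    calc b ^ (n + 1 + 1) + (n + 1 + 1) * b ^ (n + 1)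
        ≤ (b ^ (n + 1) + (n + 1) * b ^ n) * (b + 1) := by
          have : 0 ≤ (n + 1) * b ^ n := Nat.zero_le _
          ring_nf at this ⊢
          omega
      _ ≤ (b + 1) ^ (n + 1) * (b + 1) := by gcongr
      _ = _ := (pow_succ _ _).symm

/-- An `L`-fold reduction by the factor `1 - 1 / L` more than halves a quantity. -/
theorem two_mul_pred_pow_lt {L : ℕ} (hL : 2 ≤ L) : 2 * (L - 1) ^ L < L ^ L := by
  obtain ⟨b, rfl⟩ : ∃ b, L = b + 1 + 1 := ⟨L - 2, by omega⟩
  rw [Nat.add_sub_cancel]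
  have h := pow_succ_add_mul_pow_le (b + 1) (b + 1)
  have h2 : 0 < (b + 1) ^ (b + 1) := by positivity
  calc 2 * (b + 1) ^ (b + 1 + 1) < (b + 1) ^ (b + 1 + 1) + (b + 1 + 1) * (b + 1) ^ (b + 1) := by
        rw [pow_succ (b + 1) (b + 1)]
        nlinarith
    _ ≤ _ := h

open Classical in
/-- A sparse graph of girth at least `k` has an extension of girth at least `k`, with new edges
inside `N` only, in which no subset of `N` of cardinality `4 * M` is independent. -/
theorem exists_extension_indepSubsets_eq_empty [Fintype V] {G₀ : SimpleGraph V} {D k M L : ℕ}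
    {N : Finset V} (hD0 : 0 < D) (hk : 0 < k) (hL : 2 ≤ L) (hN0 : 0 < N.card)
    (hD : ∀ v, G₀.degree v ≤ D) (hM : (D + 1) ^ k ≤ M) (hg : k ≤ G₀.egirth)
    (hm : 2 * (G₀.edgeFinset.card + L * N.card) ≤ 2 * M * D)
    (hN : N.card * N.card ≤ L * (2 * M * M)) :
    ∃ G : SimpleGraph V, G₀ ≤ G ∧ (∀ u v, G.Adj u v → ¬ G₀.Adj u v → u ∈ N ∧ v ∈ N) ∧
      k ≤ G.egirth ∧ G.indepSubsets N (4 * M) = ∅ := by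
  obtain ⟨G, h1, h2, h3, -, -, h4⟩ :=
    exists_greedy_extension hD0 hk hD hM hg hm hN (L * N.card) le_rfl
  refine ⟨G, h1, h2, h3, ?_⟩
  by_contra hne
  have hpos : 1 ≤ (G.indepSubsets N (4 * M)).card :=
    Finset.card_pos.mpr (Finset.nonempty_iff_ne_empty.mpr hne)
  have hlt : (2 * (L - 1) ^ L) ^ N.card < (L ^ L) ^ N.card :=
    Nat.pow_lt_pow_left (two_mul_pred_pow_lt hL) hN0.ne'
  rw [mul_pow, ← pow_mul, ← pow_mul] at hlt
  exact absurd ((Nat.le_mul_of_pos_left _ hpos).trans h4) (not_le.mpr hlt)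

/-! ### Packings and star forests -/

theorem isPacking_iff {G : SimpleGraph V} {P : Finset V} : G.IsPacking P ↔
    ∀ x ∈ P, ∀ y ∈ P, x ≠ y → ¬ G.Adj x y ∧ ∀ z, G.Adj x z → ¬ G.Adj z y := by
  refine forall₅_congr fun x _ y _ hxy => ⟨fun h => ⟨fun h1 => ?_, fun z h1 h2 => ?_⟩, fun h => ?_⟩
  · have := h.trans (edist_le h1.toWalk)
    norm_num [Adj.toWalk] at this
  · have := h.trans (edist_le (.cons h1 h2.toWalk))
    norm_num [Adj.toWalk] at this
  · refine le_iInf fun p => ?_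
    cases p with
    | nil => exact absurd rfl hxy
    | cons h1 p =>
      cases p with
      | nil => exact absurd h1 h.1
      | cons h2 p =>
        cases p with
        | nil => exact absurd h2 (h.2 _ h1)
        | cons h3 p =>
          simp only [Walk.length_cons]
          norm_cast
          omega

/-- A packing remains one if edges are added that have no end in it. -/
theorem IsPacking.of_le {G H : SimpleGraph V} {P : Finset V} (hP : G.IsPacking P)
    (h : ∀ u v, H.Adj u v → G.Adj u v ∨ u ∉ P ∧ v ∉ P) : H.IsPacking P := by
  rw [isPacking_iff] at hP ⊢
  intro x hx y hy hxy
  obtain ⟨h1, h2⟩ := hP x hx y hy hxy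
  have hx' : ∀ z, H.Adj x z → G.Adj x z := fun z hz => (h x z hz).resolve_right fun h => h.1 hx
  have hy' : ∀ z, H.Adj z y → G.Adj z y := fun z hz => (h z y hz).resolve_right fun h => h.2 hy
  exact ⟨fun h3 => h1 (hx' y h3), fun z h3 h4 => h2 z (hx' z h3) (hy' z h4)⟩

/-- The disjoint union of stars with centres `B`, each of which has `k` leaves. -/
def starForest (B : Type*) (k : ℕ) : SimpleGraph (B ⊕ B × Fin k) where
  Adj
    | .inl b, .inr q => q.1 = b
    | .inr q, .inl b => q.1 = b
    | _, _ => False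
  symm := ⟨by rintro (b | q) (b' | q') h <;> exact h⟩
  loopless := ⟨by rintro (b | q) h <;> exact h⟩

section starForest

variable {B : Type*} {k : ℕ}

@[simp] theorem starForest_adj_inl_inl {b c : B} : ¬ (starForest B k).Adj (.inl b) (.inl c) := id

@[simp] theorem starForest_adj_inr_inr {q r : B × Fin k} :
    ¬ (starForest B k).Adj (.inr q) (.inr r) := id

@[simp] theorem starForest_adj_inl_inr {b : B} {q : B × Fin k} :
    (starForest B k).Adj (.inl b) (.inr q) ↔ q.1 = b := Iff.rfl

@[simp] theorem starForest_adj_inr_inl {b : B} {q : B × Fin k} :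
    (starForest B k).Adj (.inr q) (.inl b) ↔ q.1 = b := Iff.rfl

theorem isAcyclic_starForest : (starForest B k).IsAcyclic := by
  have key : ∀ q : B × Fin k, ((starForest B k).neighborSet (.inr q)).Subsingleton := by
    rintro q (b | r) h (c | r') h' <;> simp_all
  refine isAcyclic_of_forall_adj_exists_leaf fun u v h => ?_
  rcases u with b | q
  · rcases v with c | r
    · exact absurd h starForest_adj_inl_inl
    · exact Or.inr (key r)
  · exact Or.inl (key q)

theorem isPacking_starForest [Fintype B] :
    (starForest B k).IsPacking (Finset.univ.map Function.Embedding.inl) := by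
  rw [isPacking_iff]
  simp only [Finset.mem_map, Finset.mem_univ, true_and, forall_exists_index]
  rintro _ b rfl _ c rfl hbc
  refine ⟨starForest_adj_inl_inl, ?_⟩
  rintro (d | q)
  · simp
  · simp only [Function.Embedding.inl_apply, starForest_adj_inl_inr, starForest_adj_inr_inl]
    rintro rfl rfl
    exact hbc rfl

open Classical in
theorem degree_starForest_inl [Fintype B] (b : B) : (starForest B k).degree (.inl b) = k := by
  have : (starForest B k).neighborFinset (.inl b) =
      Finset.univ.image fun i : Fin k => Sum.inr (b, i) := by
    ext (c | q)
    · simp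
    · obtain ⟨c, i⟩ := q
      simp [eq_comm]
  rw [← card_neighborFinset_eq_degree, this, Finset.card_image_of_injective _ (fun i j h => by
    simpa using h), Finset.card_univ, Fintype.card_fin]

open Classical in
theorem degree_starForest_inr_le [Fintype B] (q : B × Fin k) :
    (starForest B k).degree (.inr q) ≤ 1 := by
  rw [← card_neighborFinset_eq_degree, Finset.card_le_one]
  rintro (b | r) h (c | r') h' <;> simp_all

end starForest

open Classical in
/-- There are graphs of large girth in which a packing `P` of vertices of degree at least `k` is
large compared with the independent sets avoiding `P`. -/
theorem exists_packing_indepSet_lt (k : ℕ) (hk : 0 < k) :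
    ∃ (V : Type) (_ : Fintype V) (G : SimpleGraph V) (P : Finset V) (s : ℕ),
      0 < s ∧ 2 * k * s ≤ P.card ∧ G.IsPacking P ∧ (∀ p ∈ P, k ≤ G.degree p) ∧
        k ≤ G.egirth ∧
        ∀ I : Finset V, Disjoint I P → G.IsIndepSet (I : Set V) → I.card < s := by
  classical
  -- `M` bounds the size of a ball, there are `8 * k * M` stars, and a joinable pair is one of at
  -- least `2 * M ^ 2` among the `(8 * k ^ 2 * M) ^ 2` pairs of leaves, which determines `L`; then
  -- `D` is so large that at most `2 * M` vertices get saturated.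
  obtain ⟨D, hDdef⟩ : ∃ D, D = 264 * k ^ 6 := ⟨_, rfl⟩
  obtain ⟨M, hMdef⟩ : ∃ M, M = (D + 1) ^ k := ⟨_, rfl⟩
  obtain ⟨L, hLdef⟩ : ∃ L, L = 32 * k ^ 4 := ⟨_, rfl⟩
  have hM0 : 0 < M := by rw [hMdef]; positivity
  have hD0 : 0 < D := by rw [hDdef]; positivity
  have hk4 : 1 ≤ k ^ 4 := Nat.one_le_pow _ _ hk
  have hkD : k ≤ D := by
    rw [hDdef]
    have := Nat.le_self_pow (n := 6) (by norm_num) k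
    omega
  let B := Fin (8 * k * M)
  let N : Finset (B ⊕ B × Fin k) := Finset.univ.map Function.Embedding.inr
  have hN : N.card = 8 * k * M * k := by simp [N, B]
  have hdeg : ∀ v, (starForest B k).degree v ≤ k := by
    rintro (b | q)
    · exact (degree_starForest_inl b).le
    · exact (degree_starForest_inr_le q).trans hk
  have hE : 2 * (starForest B k).edgeFinset.card ≤ (8 * k * M + 8 * k * M * k) * k := by
    rw [← sum_degrees_eq_twice_card_edges]
    refine (Finset.sum_le_card_nsmul _ _ k fun v _ => hdeg v).trans (le_of_eq ?_)
    simp [B]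
  have hm : 2 * ((starForest B k).edgeFinset.card + L * N.card) ≤ 2 * M * D := by
    have h1 : (8 * k * M + 8 * k * M * k) * k ≤ 16 * k ^ 6 * M := by
      have h2 : k ^ 2 ≤ k ^ 6 := Nat.pow_le_pow_right hk (by norm_num)
      have h3 : k ^ 3 ≤ k ^ 6 := Nat.pow_le_pow_right hk (by norm_num)
      calc _ = (8 * k ^ 2 + 8 * k ^ 3) * M := by ring
        _ ≤ _ := Nat.mul_le_mul_right M (by omega)
    rw [mul_add, hN, hLdef, hDdef]
    calc _ ≤ 16 * k ^ 6 * M + 2 * (32 * k ^ 4 * (8 * k * M * k)) :=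
          Nat.add_le_add_right (hE.trans h1) _
      _ = _ := by ring
  obtain ⟨G, hle, hnew, hg, hI⟩ := exists_extension_indepSubsets_eq_empty (G₀ := starForest B k)
    (N := N) hD0 hk (by omega : 2 ≤ L) (by rw [hN]; positivity)
    (fun v => (hdeg v).trans hkD) hMdef.ge
    (by rw [isAcyclic_starForest.egirth_eq_top]; exact le_top) hm
    (by rw [hN, hLdef]; exact le_of_eq (by ring))
  refine ⟨B ⊕ B × Fin k, inferInstance, G,
    Finset.univ.map Function.Embedding.inl, 4 * M, by omega, ?_, ?_, ?_, hg, ?_⟩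
  · rw [Finset.card_map, Finset.card_univ, Fintype.card_fin]
    exact le_of_eq (by ring)
  · refine isPacking_starForest.of_le fun u v h => ?_
    by_cases h0 : (starForest B k).Adj u v
    · exact Or.inl h0
    · obtain ⟨h1, h2⟩ := hnew u v h h0
      obtain ⟨q, -, rfl⟩ := Finset.mem_map.mp h1
      obtain ⟨r, -, rfl⟩ := Finset.mem_map.mp h2
      simp
  · intro p hp
    obtain ⟨b, -, rfl⟩ := Finset.mem_map.mp hp
    exact (degree_starForest_inl b).ge.trans (degree_le_of_le hle)
  · intro I hIP hind
    by_contra! hcard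
    obtain ⟨J, hJ, hJc⟩ := Finset.exists_subset_card_eq hcard
    have : J ∈ G.indepSubsets N (4 * M) := by
      refine mem_indepSubsets.mpr ⟨fun x hx => ?_, hJc, hind.mono (by exact_mod_cast hJ)⟩
      rcases x with b | q
      · exact absurd (Finset.mem_map_of_mem _ (Finset.mem_univ b))
          (Finset.disjoint_left.mp hIP (hJ hx))
      · exact Finset.mem_map_of_mem _ (Finset.mem_univ q)
    rw [hI] at this
    exact absurd this (Finset.notMem_empty _)

/-! ### Minimum degree and connectivity -/

open Classical in
/-- Deleting few vertices leaves minimum degree `k`: if vertices of degree less than `k` are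
removed one after the other together with their remaining neighbors, then the chosen vertices
form an independent set, so that at most `k * s` vertices are removed. -/
theorem exists_subset_card_le_forall_le_card_adj [Fintype V] {G : SimpleGraph V} {N : Finset V}
    {k s : ℕ} (hN : ∀ I ⊆ N, G.IsIndepSet (I : Set V) → I.card ≤ s) :
    ∃ R ⊆ N, R.card ≤ k * s ∧
      ∀ v ∈ N \ R, k ≤ ((N \ R).filter fun w => G.Adj v w).card := by
  let good : Finset V → Prop := fun R => R ⊆ N ∧ ∃ I ⊆ R, G.IsIndepSet (I : Set V) ∧
    R.card ≤ k * I.card ∧ ∀ u ∈ I, ∀ w ∈ N \ R, ¬ G.Adj u w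
  obtain ⟨R, ⟨hRN, I, hIR, hI, hRc, hIN⟩, hmax⟩ :=
    (Set.toFinite {R | good R}).exists_maximal ⟨∅, by simp, ∅, by simp⟩
  refine ⟨R, hRN, hRc.trans (Nat.mul_le_mul_left k (hN I (hIR.trans hRN) hI)), ?_⟩
  intro v hv
  by_contra! hlt
  obtain ⟨hvN, hvR⟩ := Finset.mem_sdiff.mp hv
  set T := (N \ R).filter fun w => G.Adj v w with hT
  have hvI : v ∉ I := fun h => hvR (hIR h)
  have hgood : good (insert v (R ∪ T)) := by
    refine ⟨?_, insert v I, ?_, ?_, ?_, ?_⟩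
    · intro x
      grind
    · exact Finset.insert_subset_insert _ (hIR.trans Finset.subset_union_left)
    · rw [Finset.coe_insert]
      refine hI.insert fun u hu _ => ⟨fun h => ?_, ?_⟩
      · exact hIN u hu v hv h.symm
      · exact hIN u hu v hv
    · rw [Finset.card_insert_of_notMem hvI]
      have h1 := Finset.card_insert_le v (R ∪ T)
      have h2 := Finset.card_union_le R T
      rw [mul_add]
      omega
    · intro u hu w hw h
      simp only [Finset.mem_sdiff, Finset.mem_insert, Finset.mem_union, not_or] at hw hu
      rcases hu with rfl | hu
      · exact hw.2.2.2 (by rw [hT]; simp [hw, h])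
      · exact hIN u hu w (by simp [hw]) h
  exact hvR (hmax hgood (fun x hx => by simp [hx]) (by simp))

open Classical in
theorem le_degree_induce [Fintype V] {G : SimpleGraph V} {W : Set V} {x : W} {T : Finset V} {k : ℕ}
    (hk : k ≤ T.card) (hTW : ∀ y ∈ T, y ∈ W) (hT : ∀ y ∈ T, G.Adj x y) :
    k ≤ (G.induce W).degree x := by
  rw [← card_neighborFinset_eq_degree]
  refine hk.trans ?_
  rw [← Finset.card_attach]
  refine Finset.card_le_card_of_injOn (fun y => ⟨y.1, hTW _ y.2⟩) ?_ ?_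
  · intro y _
    simpa using hT _ y.2
  · intro y _ z _ h
    exact Subtype.ext (congrArg (fun t : W => (t : V)) h)

open Classical in
/-- There are graphs of large girth and minimum degree in which a packing `P` is large compared
with the independent sets avoiding `P`. -/
theorem exists_packing_indepSet_le_of_degree (k : ℕ) (hk : 0 < k) :
    ∃ (V : Type) (_ : Fintype V) (G : SimpleGraph V) (P : Finset V) (s : ℕ),
      0 < s ∧ k * s ≤ P.card ∧ G.IsPacking P ∧ (∀ v, k ≤ G.degree v) ∧
        k ≤ G.egirth ∧
        ∀ I : Finset V, Disjoint I P → G.IsIndepSet (I : Set V) → I.card ≤ s := by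
  classical
  obtain ⟨V, _, G, P, s, hs, hPs, hP, hdeg, hg, hind⟩ := exists_packing_indepSet_lt k hk
  obtain ⟨R, hRN, hRs, hR⟩ := exists_subset_card_le_forall_le_card_adj (G := G) (N := Pᶜ) (k := k)
    (s := s) fun I hI h => (hind I (Finset.disjoint_left.mpr fun x hx => by
      simpa using hI hx) h).le
  -- the centres that keep all of their neighbors
  set Q := P.filter fun p => ∀ w, G.Adj p w → w ∉ R with hQ
  have hPQ : (P \ Q).card ≤ R.card := by
    have hex : ∀ p ∈ P \ Q, ∃ w, G.Adj p w ∧ w ∈ R := by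
      intro p hp
      simpa [hQ, (Finset.mem_sdiff.mp hp).1] using (Finset.mem_sdiff.mp hp).2
    choose! f hf using hex
    refine Finset.card_le_card_of_injOn f (fun p hp => (hf p hp).2) fun p hp q hq hpq => ?_
    by_contra hne
    exact (isPacking_iff.mp hP p (Finset.mem_sdiff.mp hp).1 q (Finset.mem_sdiff.mp hq).1 hne).2 _
      (hf p hp).1 (hpq ▸ (hf q hq).1.symm)
  have hQP : Q ⊆ P := Finset.filter_subset _ _
  have hQs : k * s ≤ Q.card := by
    have := Finset.card_sdiff_add_card_eq_card hQP
    have h2 : 2 * k * s = k * s + k * s := by ring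
    omega
  let W : Set V := {x | x ∈ Pᶜ \ R ∨ x ∈ Q}
  refine ⟨W, inferInstance, G.induce W,
    Finset.univ.filter fun x : W => (x : V) ∈ Q, s, hs, ?_, ?_, ?_, ?_, ?_⟩
  · refine hQs.trans ?_
    rw [← Finset.card_attach]
    refine Finset.card_le_card_of_injOn (fun y => ⟨y.1, Or.inr y.2⟩) (fun y _ => ?_)
      fun y _ z _ h => ?_
    · simp
    · exact Subtype.ext (congrArg (fun t : W => (t : V)) h)
  · rw [isPacking_iff] at hP ⊢
    intro x hx y hy hxy
    obtain ⟨h1, h2⟩ := hP x (hQP (by simpa using hx)) y (hQP (by simpa using hy))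
      (fun h => hxy (Subtype.ext h))
    exact ⟨h1, fun z => h2 z⟩
  · rintro ⟨v, hv | hv⟩
    · convert le_degree_induce (x := (⟨v, Or.inl hv⟩ : W)) (hR v hv)
        (fun y hy => Or.inl (Finset.mem_filter.mp hy).1) fun y hy => (Finset.mem_filter.mp hy).2
    · have h1 : k ≤ (G.neighborFinset v).card := hdeg v (hQP hv)
      convert le_degree_induce (x := (⟨v, Or.inr hv⟩ : W)) h1 (fun y hy => ?_)
        fun y hy => (G.mem_neighborFinset _ _).mp hy
      rw [mem_neighborFinset] at hy
      refine Or.inl (Finset.mem_sdiff.mpr ⟨Finset.mem_compl.mpr fun hyP => ?_, ?_⟩)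
      · exact (isPacking_iff.mp hP v (hQP hv) y hyP hy.ne).1 hy
      · exact (Finset.mem_filter.mp hv).2 y hy
  · exact hg.trans (IsContained.egirth_le ⟨(Embedding.induce W).toCopy⟩)
  · intro I hI hIi
    rw [← Finset.card_map (Function.Embedding.subtype _)]
    refine (hind _ (Finset.disjoint_left.mpr ?_) ?_).le
    · simp only [Finset.mem_map, Function.Embedding.subtype_apply]
      rintro _ ⟨x, hx, rfl⟩ hxP
      have hxQ : (x : V) ∉ Q := by simpa using Finset.disjoint_left.mp hI hx
      rcases x.2 with h | h
      · simp [hxP] at h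
      · exact hxQ h
    · intro x hx y hy hxy
      obtain ⟨x', hx', rfl⟩ := Finset.mem_map.mp hx
      obtain ⟨y', hy', rfl⟩ := Finset.mem_map.mp hy
      exact hIi hx' hy' fun h => hxy (congrArg _ h)

/-- Joining different components outside a packing makes a graph connected and keeps its girth. -/
theorem exists_connected_extension [Finite V] [Nonempty V] {G : SimpleGraph V} {P : Finset V}
    {k : ℕ} (hP : G.IsPacking P) (hadj : ∀ v ∈ P, ∃ w, G.Adj v w) (hg : k ≤ G.egirth) :
    ∃ H : SimpleGraph V, G ≤ H ∧ H.Connected ∧ H.IsPacking P ∧ k ≤ H.egirth := by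
  obtain ⟨H, ⟨hGH, hHP, hHg⟩, hmax⟩ :=
    (Set.toFinite {H : SimpleGraph V | G ≤ H ∧ H.IsPacking P ∧ k ≤ H.egirth}).exists_maximal
      ⟨G, le_rfl, hP, hg⟩
  refine ⟨H, hGH, ⟨?_⟩, hHP, hHg⟩
  have key : ∀ u v, u ∉ P → v ∉ P → H.Reachable u v := by
    intro u v hu hv
    by_contra hr
    have huv : u ≠ v := by
      rintro rfl
      exact hr .rfl
    have hle : H ⊔ edge u v ≤ H := hmax ⟨hGH.trans le_sup_left, ?_, ?_⟩ le_sup_left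
    · exact hr (hle (Or.inr (by simp [edge_adj, huv]))).reachable
    · refine hHP.of_le fun x y h => ?_
      rw [sup_adj, edge_adj] at h
      grind
    · exact le_egirth_sup_edge hHg fun p => absurd ⟨p⟩ hr
  have hout : ∀ u, ∃ u', u' ∉ P ∧ H.Reachable u u' := by
    intro u
    by_cases hu : u ∈ P
    · obtain ⟨w, hw⟩ := hadj u hu
      exact ⟨w, fun h => (isPacking_iff.mp hP u hu w h hw.ne).1 hw, (hGH hw).reachable⟩
    · exact ⟨u, hu, .rfl⟩
  intro u v
  obtain ⟨u', hu', huu'⟩ := hout u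
  obtain ⟨v', hv', hvv'⟩ := hout v
  exact huu'.trans ((key u' v' hu' hv').trans hvv'.symm)

/-- The function that equals `2` on a packing and `0` elsewhere is an independent broadcast. -/
theorem two_mul_card_le_broadcastIndepNum [Fintype V] {G : SimpleGraph V} {P : Finset V}
    (hG : G.Connected) (hP : G.IsPacking P) (hcard : 1 < P.card) :
    2 * P.card ≤ G.broadcastIndepNum := by
  classical
  refine (isGreatest_broadcastIndepNum hG).2 ⟨fun v => if v ∈ P then 2 else 0, ⟨?_, ?_⟩, ?_⟩
  · intro x
    by_cases hx : x ∈ P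
    · obtain ⟨y, hy, hyx⟩ := Finset.exists_mem_ne hcard x
      have h2 : ((2 : ℕ) : ℕ∞) ≤ 3 := by norm_num
      simpa [hx] using h2.trans ((hP x hx y hy hyx.symm).trans G.edist_le_eccent)
    · simp [hx]
  · intro x y hxy hx hy
    have hx' : x ∈ P := by by_contra h; simp [h] at hx
    have hy' : y ∈ P := by by_contra h; simp [h] at hy
    refine lt_of_lt_of_le ?_ (hP x hx' y hy' hxy)
    simp only [hx', hy', if_true, max_self]
    norm_num
  · rw [Finset.sum_ite_mem, Finset.univ_inter, Finset.sum_const, smul_eq_mul, mul_comm]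

/-- For `k ≥ 3` a connected graph of minimum degree at least `k` is not a tree, so that its girth is
not the junk value `0` of acyclic graphs. -/
theorem exists_connected_packingNum_ge (k : ℕ) (hk : 3 ≤ k) :
    ∃ (V : Type) (_ : Fintype V) (G : SimpleGraph V) (_ : DecidableRel G.Adj),
      G.Connected ∧ k ≤ G.girth ∧ k ≤ G.minDegree ∧
        2 * G.packingNum ≤ G.broadcastIndepNum ∧
        (1 - 1 / (k : ℝ)) * G.indepNum ≤ G.packingNum := by
  classical
  obtain ⟨V, _, G, P, s, hs, hPs, hP, hdeg, hg, hind⟩ :=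
    exists_packing_indepSet_le_of_degree k (by omega)
  have hPk : k ≤ P.card := (Nat.le_mul_of_pos_right k hs).trans hPs
  obtain ⟨p, hp⟩ : P.Nonempty := Finset.card_pos.mp (by omega)
  have : Nonempty V := ⟨p⟩
  have hadj : ∀ v, ∃ w, G.Adj v w := fun v => by
    have := hdeg v
    exact (G.degree_pos_iff_exists_adj v).mp (by omega)
  obtain ⟨H, hGH, hHc, hHP, hHg⟩ := exists_connected_extension hP (fun v _ => hadj v) hg
  have hmin : k ≤ H.minDegree :=
    H.le_minDegree_of_forall_le_degree k fun v => (hdeg v).trans (degree_le_of_le hGH)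
  have hcyc : ¬ H.IsAcyclic := by
    intro hac
    obtain ⟨w, hw⟩ := hadj p
    have : Nontrivial V := ⟨p, w, hw.ne⟩
    have := (IsTree.mk hHc hac).minDegree_eq_one_of_nontrivial
    omega
  obtain ⟨Q, hQ, hQc⟩ := (isGreatest_packingNum H).1
  have hPQ : P.card ≤ H.packingNum := (isGreatest_packingNum H).2 ⟨P, hHP, rfl⟩
  refine ⟨V, inferInstance, H, Classical.decRel _, hHc, ?_, ?_, ?_, ?_⟩
  · obtain ⟨a, w, hw, hl⟩ := exists_girth_eq_length.mpr hcyc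
    rw [hl]
    exact_mod_cast le_egirth.mp hHg a w hw
  · convert hmin
  · rw [← hQc]
    exact two_mul_card_le_broadcastIndepNum hHc hQ (by omega)
  · obtain ⟨I, hI⟩ := H.exists_isNIndepSet_indepNum
    have h1 : I.card ≤ s + P.card := by
      have h2 := hind (I \ P) Finset.sdiff_disjoint fun x hx y hy hxy h =>
        hI.1 (Finset.mem_sdiff.mp hx).1 (Finset.mem_sdiff.mp hy).1 hxy (hGH h)
      have h3 := Finset.card_le_card_sdiff_add_card (s := I) (t := P)
      omega
    rw [hI.2] at h1
    have hk0 : (0 : ℝ) < k := by positivity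
    have h4 : (H.indepNum : ℝ) ≤ s + P.card := by exact_mod_cast h1
    have h5 : (k : ℝ) * s ≤ P.card := by exact_mod_cast hPs
    have h6 : (P.card : ℝ) ≤ H.packingNum := by exact_mod_cast hPQ
    have h7 : (0 : ℝ) ≤ s := by positivity
    refine le_trans ?_ h6
    rw [one_sub_div hk0.ne', div_mul_eq_mul_div, div_le_iff₀ hk0]
    have h8 : (0 : ℝ) ≤ k - 1 := by
      have : (3 : ℝ) ≤ k := by exact_mod_cast hk
      linarith
    nlinarith [mul_le_mul_of_nonneg_left h4 h8]

end SimpleGraph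

theorem theorem2 (k : ℕ) (hk : 0 < k) :
    ∃ (V : Type) (_ : Fintype V) (G : SimpleGraph V) (_ : DecidableRel G.Adj),
      G.Connected ∧ k ≤ G.girth ∧ k ≤ G.minDegree ∧
        (G.broadcastIndepNum : ℝ) ≥ 2 * (1 - 1 / (k : ℝ)) * (G.indepNum : ℝ) ∧
        (G.packingNum : ℝ) ≥ (1 - 1 / (k : ℝ)) * (G.indepNum : ℝ) := by
  -- the bounds for `k + 2` are stronger than those for `k`
  obtain ⟨V, hV, G, hG, hc, hg, hd, hb, hp⟩ :=
    SimpleGraph.exists_connected_packingNum_ge (k + 2) (by omega)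
  have hk0 : (0 : ℝ) < k := by exact_mod_cast hk
  have h1 : (1 - 1 / (k : ℝ)) * G.indepNum ≤ G.packingNum := by
    refine le_trans ?_ hp
    gcongr
    simp
  have h2 : (2 : ℝ) * G.packingNum ≤ G.broadcastIndepNum := by exact_mod_cast hb
  exact ⟨V, hV, G, hG, hc, by omega, by omega, by linarith, h1⟩
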